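/- Let $d\ge 1$ and let $(\Omega,\mathcal F)$ be a measurable space with a measurable flow $(\theta_s)_{s\in\mathbb R^d}$, i.e. $(\omega,s)\mapsto\theta_s\omega$ is measurable, $\theta_0=\mathrm{id}$ and $\theta_s\circ\theta_t=\theta_{s+t}$. Let $\mathbb P$ be a probability measure on $\Omega$ that is stationary (invariant under every $\theta_s$) and ergodic (every event invariant under all $\theta_s$ has probability $0$ or $1$). Let $\Phi,\Psi$ be ergodic random measures on $\mathbb R^d$, i.e. measurable maps $\omega\mapsto\Phi_\omega,\Psi_\omega$ from $\Omega$ to the locally finite Borel measures on $\mathbb R^d$ that are flow-adapted: $\Phi_{\theta_s\omega}(B)=\Phi_\omega(B+s)$ and $\Psi_{\theta_s\omega}(B)=\Psi_\omega(B+s)$ for all $s$, $\omega$ and Borel $B$. Suppose that their intensities $\lambda_\Phi,\lambda_\Psi$, defined by $\mathbb E[\Phi(B)]=\lambda_\Phi\,\mathrm{Leb}(B)$ and $\mathbb E[\Psi(B)]=\lambda_\Psi\,\mathrm{Leb}(B)$ for all Borel $B$, are positive and finite. For locally finite Borel measures $\varphi,\psi$ on $\mathbb R^d$, a measurable $f:\mathbb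 R^d\times\mathbb R^d\to[0,\infty)$ is a *sub-balancing density* if $\int f(x,\xi)\,\psi(d\xi)\le 1$ for all $x$ and $\int f(x,\xi)\,\varphi(dx)\le 1$ for all $\xi$. It is *balancing* if moreover equality holds for $\varphi$-a.e. $x$ and for $\psi$-a.e. $\xi$, and a sub-balancing density is *constrained* if $f\le 1$ everywhere. A point (site) $x\in\mathbb R^d$ is *exhausted* if $\int f(x,\xi)\,\psi(d\xi)=1$ and *unexhausted* otherwise; a point (center) $\xi\in\mathbb R^d$ is *sated* if $\int f(x,\xi)\,\varphi(dx)=1$ and *unsated* otherwise. A site $x_0$ *desires* a center $\xi_0$ if $f(x_0,\xi_0)<1$ and either $x_0$ is unexhausted or there is $\xi_1\in\mathbb R^d$ with $|x_0-\xi_1|>|x_0-\xi_0|$ and $f(x_0,\xi_1)>0$; symmetrically, $\xi_0$ *desires* $x_0$ if $f(x_0,\xi_0)<1$ and either $\xi_0$ is unsated or there is $x_1\in\mathbb R^d$ with $|x_1-\xi_0|>|x_0-\xi_0|$ and $f(x_1,\xi_0)>0$. A constrained density is *stable* if no pair $(x_0,\xi_0)\in\mathbb R^d\times\mathbb R^d$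 is such that $x_0$ desires $\xi_0$ and $\xi_0$ desires $x_0$. Let $F=F_\omega(x,\xi)$ be a real function, jointly measurable in $(\omega,x,\xi)$ and flow-adapted, i.e. $F_{\theta_s\omega}(x,\xi)=F_\omega(x+s,\xi+s)$, such that almost surely $F_\omega$ is a stable constrained density for $\Phi_\omega$ and $\Psi_\omega$. Then almost surely: 1. if $\lambda_\Phi=\lambda_\Psi$, then $F_\omega$ is balancing for $\Phi_\omega$ and $\Psi_\omega$, i.e. the set of unexhausted sites has zero $\Phi_\omega$-measure and the set of unsated centers has zero $\Psi_\omega$-measure; 2. if $\lambda_\Phi<\lambda_\Psi$, then there is no unexhausted site, but the set of unsated centers has infinite $\Psi_\omega$-measure; 3. if $\lambda_\Phi>\lambda_\Psi$, then there is no unsated center, but the set of unexhausted sites has infinite $\Phi_\omega$-measure. -/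

import Mathlib

open MeasureTheory
open scoped ENNReal

namespace StableTransport

/-- `ℝ^d` with the Euclidean distance and Lebesgue measure `volume`. -/
abbrev E (d : ℕ) : Type := EuclideanSpace ℝ (Fin d)

/-! ### Random measures

The measurable flow `θ_s` on `Ω` is an additive action of `ℝ^d` on `Ω`, `θ_s ω = s +ᵥ ω`, that is
jointly measurable in `(s, ω)` (`MeasurableVAdd₂`). -/

section Random

variable {d : ℕ} {Ω : Type*} [MeasurableSpace Ω] [AddAction (E d) Ω]

/-- The translated measure `θ_s φ`, given by `θ_s φ (B) = φ (B + s)`. -/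
noncomputable def shiftMeasure (s : E d) (φ : Measure (E d)) : Measure (E d) :=
  φ.map (fun x => x - s)

theorem shiftMeasure_apply (s : E d) (φ : Measure (E d)) {B : Set (E d)} (hB : MeasurableSet B) :
    shiftMeasure s φ B = φ ((fun x => x + s) '' B) := by
  rw [shiftMeasure, Measure.map_apply (by fun_prop) hB]
  congr 1
  ext x
  constructor
  · intro hx
    exact ⟨x - s, hx, by simp⟩
  · rintro ⟨y, hy, rfl⟩
    simpa using hy

/-- `P` is a stationary and ergodic probability measure: it is invariant under the flow, and every
event that is invariant under the whole flow has probability `0` or `1`. -/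
structure IsErgodic (d : ℕ) {Ω : Type*} [MeasurableSpace Ω] [AddAction (E d) Ω]
    (P : Measure Ω) : Prop where
  isProbabilityMeasure : IsProbabilityMeasure P
  stationary : ∀ s : E d, ∀ A : Set Ω, MeasurableSet A → P ((fun ω => s +ᵥ ω) ⁻¹' A) = P A
  ergodic : ∀ A : Set Ω, MeasurableSet A → (∀ s : E d, (fun ω => s +ᵥ ω) ⁻¹' A = A) →
    P A = 0 ∨ P A = 1

/-- `Φ` is a measurable flow-adapted map from `Ω` to the locally finite measures on `ℝ^d`
(with the σ-field generated by the evaluations `μ ↦ μ B`). -/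
structure IsFlowAdaptedMeasure (Φ : Ω → Measure (E d)) : Prop where
  locallyFinite : ∀ ω, IsLocallyFiniteMeasure (Φ ω)
  measurable : Measurable Φ
  flowAdapted : ∀ (s : E d) (ω : Ω), Φ (s +ᵥ ω) = shiftMeasure s (Φ ω)

/-- `(P, Φ)` is an ergodic (stationary) random measure. -/
structure IsErgodicRandomMeasure (P : Measure Ω) (Φ : Ω → Measure (E d)) : Prop where
  ergodic : IsErgodic d P
  flowAdapted : IsFlowAdaptedMeasure Φ

/-- `c` is the intensity of `(P, Φ)`: `𝔼[Φ(B)] = c · Leb(B)` for every Borel set `B`. -/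
def IsIntensity (P : Measure Ω) (Φ : Ω → Measure (E d)) (c : ℝ≥0∞) : Prop :=
  ∀ B : Set (E d), MeasurableSet B → ∫⁻ ω, Φ ω B ∂P = c * volume B

/-- `F = F_ω(x, ξ)` is a (jointly) measurable flow-adapted function:
`F_{θ_s ω}(x, ξ) = F_ω(x + s, ξ + s)`. -/
structure IsFlowAdaptedFunction (F : Ω → E d → E d → ℝ) : Prop where
  measurable : Measurable (fun p : Ω × E d × E d => F p.1 p.2.1 p.2.2)
  flowAdapted : ∀ (s : E d) (ω : Ω) (x ξ : E d), F (s +ᵥ ω) x ξ = F ω (x + s) (ξ + s)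

end Random

/-! ### Densities for a pair of measures `φ` (sites), `ψ` (centers) -/

section Density

variable {d : ℕ}

/-- The mass `∫ f(x, ξ) ψ(dξ)` sent out by the site `x`. -/
noncomputable def outMass (ψ : Measure (E d)) (f : E d → E d → ℝ) (x : E d) : ℝ≥0∞ :=
  ∫⁻ ξ, ENNReal.ofReal (f x ξ) ∂ψ

/-- The mass `∫ f(x, ξ) φ(dx)` received by the center `ξ`. -/
noncomputable def inMass (φ : Measure (E d)) (f : E d → E d → ℝ) (ξ : E d) : ℝ≥0∞ :=
  ∫⁻ x, ENNReal.ofReal (f x ξ) ∂φ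

structure IsSubBalancing (φ ψ : Measure (E d)) (f : E d → E d → ℝ) : Prop where
  measurable : Measurable (fun p : E d × E d => f p.1 p.2)
  nonneg : ∀ x ξ, 0 ≤ f x ξ
  outMass_le : ∀ x, outMass ψ f x ≤ 1
  inMass_le : ∀ ξ, inMass φ f ξ ≤ 1

structure IsBalancing (φ ψ : Measure (E d)) (f : E d → E d → ℝ) : Prop where
  subBalancing : IsSubBalancing φ ψ f
  outMass_eq : ∀ᵐ x ∂φ, outMass ψ f x = 1
  inMass_eq : ∀ᵐ ξ ∂ψ, inMass φ f ξ = 1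

structure IsConstrained (φ ψ : Measure (E d)) (f : E d → E d → ℝ) : Prop where
  subBalancing : IsSubBalancing φ ψ f
  le_one : ∀ x ξ, f x ξ ≤ 1

/-- The set of `f`-unexhausted points of `ℝ^d`. -/
def unexhausted (ψ : Measure (E d)) (f : E d → E d → ℝ) : Set (E d) :=
  {x | outMass ψ f x ≠ 1}

/-- The set of `f`-unsated points of `ℝ^d`. -/
def unsated (φ : Measure (E d)) (f : E d → E d → ℝ) : Set (E d) :=
  {ξ | inMass φ f ξ ≠ 1}

/-- The site `x₀` desires the center `ξ₀`. -/
def SiteDesires (ψ : Measure (E d)) (f : E d → E d → ℝ) (x₀ ξ₀ : E d) : Prop :=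
  f x₀ ξ₀ < 1 ∧ (x₀ ∈ unexhausted ψ f ∨ ∃ ξ₁, dist x₀ ξ₀ < dist x₀ ξ₁ ∧ 0 < f x₀ ξ₁)

/-- The center `ξ₀` desires the site `x₀`. -/
def CenterDesires (φ : Measure (E d)) (f : E d → E d → ℝ) (ξ₀ x₀ : E d) : Prop :=
  f x₀ ξ₀ < 1 ∧ (ξ₀ ∈ unsated φ f ∨ ∃ x₁, dist x₀ ξ₀ < dist x₁ ξ₀ ∧ 0 < f x₁ ξ₀)

/-- `f` is a stable constrained density for `φ` and `ψ`. -/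
structure IsStableConstrained (φ ψ : Measure (E d)) (f : E d → E d → ℝ) : Prop where
  constrained : IsConstrained φ ψ f
  stable : ¬ ∃ x₀ ξ₀ : E d, SiteDesires ψ f x₀ ξ₀ ∧ CenterDesires φ f ξ₀ x₀

end Density

end StableTransport

open StableTransport

/-!
Two facts drive the proof. First, a flow-covariant random measure has almost surely total mass `0`
or `∞`: normalising it to a probability measure where its mass is finite and averaging over `P`
gives a finite translation-invariant measure on `ℝ^d`, which must vanish. By ergodicity, the
unexhausted sites thus have almost surely mass `0` or almost surely mass `∞`. Second, the mass
transport principle: `P`-averaging `F_ω(x, ξ) Φ_ω(dx) Ψ_ω(dξ)` gives a measure on `ℝ^d × ℝ^d` that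
is invariant under diagonal translations, hence has equal marginals; so the mass sent out from a
Borel set and the mass received in it have the same mean.

Stability forces `F_ω = 1` on every pair of an unexhausted site and an unsated center, so the
existence of an unsated center bounds the mass of the unexhausted sites by `1`. Hence if that mass
is infinite every center is sated, while if it is zero mass transport gives `λ_Φ ≤ λ_Ψ`. When the
intensities agree and every center is sated, mass transport forces almost every site to be
exhausted, so the infinite case does not occur.
-/

namespace StableTransport

open ProbabilityTheory

section SFiniteKernel

variable {α β : Type*} [MeasurableSpace α] [MeasurableSpace β]

theorem isSFiniteKernel_of_isFiniteMeasure (κ : Kernel α β) [∀ a, IsFiniteMeasure (κ a)] :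
    IsSFiniteKernel κ := by
  classical
  let mass (a : α) : ℕ := ⌊(κ a Set.univ).toNNReal⌋₊
  have hmass (k : ℕ) : MeasurableSet (mass ⁻¹' {k}) :=
    (Nat.measurable_floor.comp (κ.measurable_coe MeasurableSet.univ).ennreal_toNNReal)
      (measurableSet_singleton k)
  let piece (k : ℕ) : Kernel α β := Kernel.piecewise (hmass k) κ 0
  have hfin (k : ℕ) : IsFiniteKernel (piece k) := by
    refine ⟨⟨k + 1, by finiteness, fun a => ?_⟩⟩
    by_cases ha : a ∈ mass ⁻¹' {k}
    · rw [Kernel.piecewise_apply, if_pos ha, ← ENNReal.coe_toNNReal (measure_ne_top (κ a) Set.univ),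
        ← Set.mem_singleton_iff.1 ha]
      exact_mod_cast (Nat.lt_floor_add_one (κ a Set.univ).toNNReal).le
    · simp [piece, Kernel.piecewise_apply, show ¬ mass a = k from ha]
  refine ⟨piece, hfin, ?_⟩
  ext a s hs
  rw [Kernel.sum_apply' _ _ hs, tsum_eq_single (mass a)]
  · simp [piece, Kernel.piecewise_apply]
  · intro k hk
    simp [piece, Kernel.piecewise_apply, hk.symm]

theorem isSFiniteKernel_of_isLocallyFiniteMeasure [TopologicalSpace β] [SigmaCompactSpace β]
    [T2Space β] [OpensMeasurableSpace β] (κ : Kernel α β) [∀ a, IsLocallyFiniteMeasure (κ a)] :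
    IsSFiniteKernel κ := by
  have hmeas : ∀ n, MeasurableSet (disjointed (compactCovering β) n) :=
    MeasurableSet.disjointed fun n => (isCompact_compactCovering β n).measurableSet
  have hpiece (n : ℕ) : IsSFiniteKernel (κ.restrict (hmeas n)) := by
    have (a : α) : IsFiniteMeasure (κ.restrict (hmeas n) a) := by
      refine ⟨?_⟩
      rw [Kernel.restrict_apply, Measure.restrict_apply_univ]
      exact (measure_mono (disjointed_subset _ n)).trans_lt
        (isCompact_compactCovering β n).measure_lt_top
    exact isSFiniteKernel_of_isFiniteMeasure _
  have hsum : κ = Kernel.sum fun n => κ.restrict (hmeas n) := by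
    ext1 a
    simp only [Kernel.sum_apply, Kernel.restrict_apply]
    rw [← Measure.restrict_iUnion (disjoint_disjointed _) hmeas, iUnion_disjointed,
      iUnion_compactCovering, Measure.restrict_univ]
  rw [hsum]
  exact Kernel.isSFiniteKernel_sum

end SFiniteKernel

theorem eq_zero_of_isFiniteMeasure_of_isAddLeftInvariant {G : Type*} [AddGroup G]
    [TopologicalSpace G] [IsTopologicalAddGroup G] [MeasurableSpace G] [BorelSpace G]
    [WeaklyLocallyCompactSpace G] [NoncompactSpace G] (m : Measure G) [m.Regular]
    [IsFiniteMeasure m] [m.IsAddLeftInvariant] : m = 0 := by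
  by_contra hm
  have : NeZero m := ⟨hm⟩
  exact measure_ne_top m Set.univ (measure_univ_of_isAddLeftInvariant m)

section DiagonalInvariance

variable {G X Y : Type*} [MeasurableSpace G] [MeasurableSpace X] [MeasurableSpace Y]

instance [VAdd G X] [VAdd G Y] [MeasurableConstVAdd G X] [MeasurableConstVAdd G Y] :
    MeasurableConstVAdd G (X × Y) :=
  ⟨fun s => (measurable_const_vadd s).prodMap (measurable_const_vadd s)⟩

variable [AddGroup G] [MeasurableAdd₂ G] [MeasurableNeg G] (ν : Measure G)
  [ν.IsAddRightInvariant] [ν.IsNegInvariant] (M : Measure (G × G)) [SFinite M]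
  [VAddInvariantMeasure G (G × G) M]

/- Both sides equal `∫∫ 1_A (p.1) 1_B (s + p.2) dM(p) dν(s)`, by invariance of `M` and `ν`. -/
theorem fst_mul_eq_snd_mul_of_vaddInvariantMeasure [SFinite ν] {A B : Set G}
    (hA : MeasurableSet A) (hB : MeasurableSet B) : M.fst A * ν B = M.snd B * ν A := by
  let a : G → ℝ≥0∞ := A.indicator 1
  let b : G → ℝ≥0∞ := B.indicator 1
  have ha : Measurable a := measurable_one.indicator hA
  have hb : Measurable b := measurable_one.indicator hB
  have hfst : ∫⁻ p, a p.1 ∂M = M.fst A := by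
    rw [← lintegral_map ha measurable_fst]
    exact lintegral_indicator_one hA
  have hsnd : ∫⁻ p, b p.2 ∂M = M.snd B := by
    rw [← lintegral_map hb measurable_snd]
    exact lintegral_indicator_one hB
  have hνA (x : G) : ∫⁻ s, a (-s + x) ∂ν = ν A := by
    rw [lintegral_neg_eq_self (fun s => a (s + x)), lintegral_add_right_eq_self]
    exact lintegral_indicator_one hA
  have hνB (x : G) : ∫⁻ s, b (s + x) ∂ν = ν B := by
    rw [lintegral_add_right_eq_self]
    exact lintegral_indicator_one hB
  calc M.fst A * ν B
      = ∫⁻ p, ∫⁻ s, a p.1 * b (s + p.2) ∂ν ∂M := by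
        rw [← hfst, ← lintegral_mul_const _ (by fun_prop)]
        refine lintegral_congr fun p => ?_
        rw [lintegral_const_mul _ (by fun_prop), hνB]
    _ = ∫⁻ s, ∫⁻ p, a p.1 * b (s + p.2) ∂M ∂ν :=
        lintegral_lintegral_swap (by unfold Function.uncurry; fun_prop)
    _ = ∫⁻ s, ∫⁻ p, a (-s + p.1) * b p.2 ∂M ∂ν := by
        refine lintegral_congr fun s => ?_
        rw [← (measurePreserving_vadd s M).lintegral_comp
          (f := fun p => a (-s + p.1) * b p.2) (by fun_prop)]
        simp
    _ = ∫⁻ p, ∫⁻ s, a (-s + p.1) * b p.2 ∂ν ∂M :=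
        (lintegral_lintegral_swap (by unfold Function.uncurry; fun_prop)).symm
    _ = M.snd B * ν A := by
        rw [← hsnd, ← lintegral_mul_const _ (by fun_prop)]
        refine lintegral_congr fun p => ?_
        rw [lintegral_mul_const _ (by fun_prop), hνA, mul_comm]

theorem fst_eq_snd_of_vaddInvariantMeasure [SigmaFinite ν] [NeZero ν] : M.fst = M.snd := by
  obtain ⟨B, hB, -, hB_pos, hB_top⟩ := Measure.exists_subset_measure_lt_top (μ := ν)
    MeasurableSet.univ (r := 0) (pos_iff_ne_zero.2 (NeZero.ne _))
  have hcancel {x y : ℝ≥0∞} : x * ν B = y * ν B ↔ x = y :=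
    ENNReal.mul_left_inj hB_pos.ne' hB_top.ne
  have hBB : M.fst B = M.snd B :=
    hcancel.1 (fst_mul_eq_snd_mul_of_vaddInvariantMeasure ν M hB hB)
  ext A hA
  rw [← hcancel, fst_mul_eq_snd_mul_of_vaddInvariantMeasure ν M hA hB, ← hBB,
    fst_mul_eq_snd_mul_of_vaddInvariantMeasure ν M hB hA]

end DiagonalInvariance

section Covariance

theorem withDensity_map {X Y : Type*} [MeasurableSpace X] [MeasurableSpace Y] (μ : Measure X)
    {T : X → Y} (hT : Measurable T) {g : Y → ℝ≥0∞} (hg : Measurable g) :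
    (μ.map T).withDensity g = (μ.withDensity (g ∘ T)).map T := by
  ext s hs
  rw [withDensity_apply _ hs, setLIntegral_map hs hg hT, Measure.map_apply hT hs,
    withDensity_apply _ (hT hs)]
  rfl

variable {G Ω X Y : Type*} [AddGroup G] [MeasurableSpace Ω] [AddAction G Ω]
  [MeasurableSpace X] [AddAction G X] [MeasurableSpace Y] [AddAction G Y]

/-- A random measure `κ` on a `G`-space `X` is covariant with the flow on `Ω` if
`κ_{θ_s ω}(B) = κ_ω(s + B)`; for `X = ℝ^d` this is flow-adaptedness. -/
def IsFlowCovariant (G : Type*) [AddGroup G] [AddAction G Ω] [AddAction G X]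
    (κ : Kernel Ω X) : Prop :=
  ∀ (s : G) (ω : Ω), κ (s +ᵥ ω) = (κ ω).map (-s +ᵥ ·)

namespace IsFlowCovariant

variable [MeasurableConstVAdd G X] [MeasurableConstVAdd G Y] {κ : Kernel Ω X} {η : Kernel Ω Y}

theorem measure_univ_vadd (hκ : IsFlowCovariant G κ) (s : G) (ω : Ω) :
    κ (s +ᵥ ω) Set.univ = κ ω Set.univ := by
  rw [hκ, Measure.map_apply (measurable_const_vadd _) MeasurableSet.univ, Set.preimage_univ]

theorem withDensity [IsSFiniteKernel κ] (hκ : IsFlowCovariant G κ) {g : Ω → X → ℝ≥0∞}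
    (hg : Measurable (Function.uncurry g)) (hg_vadd : ∀ (s : G) ω x, g (s +ᵥ ω) x = g ω (s +ᵥ x)) :
    IsFlowCovariant G (κ.withDensity g) := by
  have hgω (ω : Ω) : Measurable (g ω) := hg.comp measurable_prodMk_left
  intro s ω
  rw [Kernel.withDensity_apply _ hg, Kernel.withDensity_apply _ hg, hκ,
    withDensity_map _ (measurable_const_vadd _) (hgω _)]
  congr 2
  ext x
  simp [hg_vadd]

theorem prod [IsSFiniteKernel κ] [IsSFiniteKernel η] (hκ : IsFlowCovariant G κ)
    (hη : IsFlowCovariant G η) : IsFlowCovariant G (κ ×ₖ η) := by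
  intro s ω
  rw [Kernel.prod_apply, Kernel.prod_apply, hκ, hη,
    Measure.map_prod_map _ _ (measurable_const_vadd _) (measurable_const_vadd _)]
  rfl

theorem vaddInvariantMeasure_bind [MeasurableConstVAdd G Ω] (hκ : IsFlowCovariant G κ)
    (P : Measure Ω) [VAddInvariantMeasure G Ω P] : VAddInvariantMeasure G X (κ ∘ₘ P) := by
  refine ⟨fun s B hB => ?_⟩
  have hsB : MeasurableSet ((s +ᵥ ·) ⁻¹' B : Set X) := measurable_const_vadd s hB
  calc (κ ∘ₘ P) ((s +ᵥ ·) ⁻¹' B) = ∫⁻ ω, κ ω ((s +ᵥ ·) ⁻¹' B) ∂P :=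
        Measure.bind_apply hsB κ.aemeasurable
    _ = ∫⁻ ω, κ (-s +ᵥ ω) B ∂P := by
        refine lintegral_congr fun ω => ?_
        rw [hκ, neg_neg, Measure.map_apply (measurable_const_vadd s) hB]
    _ = ∫⁻ ω, κ ω B ∂P :=
        (measurePreserving_vadd (-s) P).lintegral_comp (κ.measurable_coe hB)
    _ = (κ ∘ₘ P) B := (Measure.bind_apply hB κ.aemeasurable).symm

/- The mean of the normalised random measure `κ_ω / κ_ω(G)`, which vanishes where `κ_ω(G) = ∞`, is
a finite invariant measure on `G`. -/
theorem ae_measure_univ_eq_zero_or_top [TopologicalSpace G] [IsTopologicalAddGroup G]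
    [MeasurableSpace G] [BorelSpace G] [WeaklyLocallyCompactSpace G] [SecondCountableTopology G]
    [NoncompactSpace G] [MeasurableConstVAdd G Ω] {P : Measure Ω} [IsFiniteMeasure P]
    [VAddInvariantMeasure G Ω P] {κ : Kernel Ω G} [IsSFiniteKernel κ] (hκ : IsFlowCovariant G κ) :
    ∀ᵐ ω ∂P, κ ω Set.univ = 0 ∨ κ ω Set.univ = ∞ := by
  have hmass : Measurable fun ω => κ ω Set.univ := κ.measurable_coe MeasurableSet.univ
  have hdensity : Measurable (Function.uncurry fun ω (_ : G) => (κ ω Set.univ)⁻¹) :=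
    hmass.inv.comp measurable_fst
  let η : Kernel Ω G := κ.withDensity fun ω _ => (κ ω Set.univ)⁻¹
  have hη_univ (ω : Ω) : η ω Set.univ = (κ ω Set.univ)⁻¹ * κ ω Set.univ := by
    simp [η, Kernel.withDensity_apply _ hdensity]
  have hη : IsFlowCovariant G η :=
    hκ.withDensity hdensity fun s ω _ => by rw [hκ.measure_univ_vadd]
  have : IsFiniteKernel η :=
    ⟨⟨1, by finiteness, fun ω => (hη_univ ω).trans_le (ENNReal.inv_mul_le_one _)⟩⟩
  have hη_mean : η ∘ₘ P = 0 := by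
    have := hη.vaddInvariantMeasure_bind P
    have : (η ∘ₘ P).IsAddLeftInvariant := ⟨fun s => (measurePreserving_vadd s _).map_eq⟩
    exact eq_zero_of_isFiniteMeasure_of_isAddLeftInvariant _
  have hη_ae : ∀ᵐ ω ∂P, η ω Set.univ = 0 := by
    refine (lintegral_eq_zero_iff (η.measurable_coe MeasurableSet.univ)).1 ?_
    rw [← Measure.bind_apply MeasurableSet.univ η.aemeasurable, hη_mean]
    rfl
  filter_upwards [hη_ae] with ω hω
  rw [hη_univ, mul_eq_zero, ENNReal.inv_eq_zero] at hω
  exact hω.symm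

end IsFlowCovariant

end Covariance

section RandomMeasure

variable {d : ℕ} {Ω : Type*} [MeasurableSpace Ω] [AddAction (E d) Ω] {P : Measure Ω}

theorem IsErgodic.vaddInvariantMeasure (hP : IsErgodic d P) : VAddInvariantMeasure (E d) Ω P :=
  ⟨fun s A hA => hP.stationary s A hA⟩

theorem IsErgodic.ae_measure_univ_eq_zero_or_ae_measure_univ_eq_top
    [MeasurableConstVAdd (E d) Ω] (hd : 1 ≤ d) (hP : IsErgodic d P) {κ : Kernel Ω (E d)}
    [IsSFiniteKernel κ] (hκ : IsFlowCovariant (E d) κ) :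
    (∀ᵐ ω ∂P, κ ω Set.univ = 0) ∨ ∀ᵐ ω ∂P, κ ω Set.univ = ∞ := by
  have := hP.isProbabilityMeasure
  have := hP.vaddInvariantMeasure
  have : Nonempty (Fin d) := Fin.pos_iff_nonempty.1 hd
  have : NoncompactSpace (E d) := NormedSpace.noncompactSpace ℝ (E d)
  have hmeas : MeasurableSet {ω | κ ω Set.univ = ∞} :=
    κ.measurable_coe MeasurableSet.univ (measurableSet_singleton ∞)
  have hinv (s : E d) : (s +ᵥ ·) ⁻¹' {ω | κ ω Set.univ = ∞} = {ω | κ ω Set.univ = ∞} := by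
    ext ω
    simp only [Set.mem_preimage, Set.mem_ofPred_eq, hκ.measure_univ_vadd]
  rcases hP.ergodic _ hmeas hinv with h | h
  · left
    filter_upwards [hκ.ae_measure_univ_eq_zero_or_top (P := P), measure_eq_zero_iff_ae_notMem.1 h]
      with ω hω hω_top using hω.resolve_right hω_top
  · exact Or.inr ((mem_ae_iff_prob_eq_one hmeas).2 h)

variable {Φ Ψ : Ω → Measure (E d)} {F : Ω → E d → E d → ℝ}

/-- A flow-adapted random measure, regarded as a kernel from `Ω` to `ℝ^d`; its Campbell measure
on `Ω × ℝ^d` is then `P ⊗ₘ hΦ.kernel`. -/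
def IsFlowAdaptedMeasure.kernel (hΦ : IsFlowAdaptedMeasure Φ) : Kernel Ω (E d) :=
  ⟨Φ, hΦ.measurable⟩

instance (hΦ : IsFlowAdaptedMeasure Φ) : IsSFiniteKernel hΦ.kernel :=
  have : ∀ ω, IsLocallyFiniteMeasure (hΦ.kernel ω) := hΦ.locallyFinite
  isSFiniteKernel_of_isLocallyFiniteMeasure _

theorem IsFlowAdaptedMeasure.sFinite (hΦ : IsFlowAdaptedMeasure Φ) (ω : Ω) : SFinite (Φ ω) :=
  inferInstanceAs (SFinite (hΦ.kernel ω))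

theorem IsFlowAdaptedMeasure.isFlowCovariant_kernel (hΦ : IsFlowAdaptedMeasure Φ) :
    IsFlowCovariant (E d) hΦ.kernel := by
  intro s ω
  refine (hΦ.flowAdapted s ω).trans (congrArg (Measure.map · (Φ ω)) ?_)
  ext1 x
  rw [vadd_eq_add, neg_add_eq_sub]

theorem IsFlowAdaptedFunction.swap (hF : IsFlowAdaptedFunction F) :
    IsFlowAdaptedFunction fun ω ξ x => F ω x ξ where
  measurable := hF.measurable.comp (measurable_id.prodMap measurable_swap)
  flowAdapted s ω ξ x := hF.flowAdapted s ω x ξ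

theorem measurable_outMass (hΨ : IsFlowAdaptedMeasure Ψ) (hF : IsFlowAdaptedFunction F) :
    Measurable fun p : Ω × E d => outMass (Ψ p.1) (F p.1) p.2 :=
  Measurable.lintegral_kernel_prod_right (κ := hΨ.kernel.comap Prod.fst measurable_fst)
    (f := fun p ξ => ENNReal.ofReal (F p.1 p.2 ξ))
    (hF.measurable.comp MeasurableEquiv.prodAssoc.measurable).ennreal_ofReal

theorem outMass_vadd (hΨ : IsFlowAdaptedMeasure Ψ) (hF : IsFlowAdaptedFunction F) (s : E d) (ω : Ω)
    (x : E d) : outMass (Ψ (s +ᵥ ω)) (F (s +ᵥ ω)) x = outMass (Ψ ω) (F ω) (s + x) := by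
  have hFω : Measurable fun ξ => ENNReal.ofReal (F ω (x + s) (ξ + s)) :=
    (hF.measurable.comp (by fun_prop : Measurable fun ξ => (ω, x + s, ξ + s))).ennreal_ofReal
  simp only [outMass, hΨ.flowAdapted, hF.flowAdapted, shiftMeasure]
  rw [lintegral_map hFω (by fun_prop)]
  simp only [sub_add_cancel, add_comm x s]

theorem measurableSet_unexhausted (hΨ : IsFlowAdaptedMeasure Ψ) (hF : IsFlowAdaptedFunction F)
    (ω : Ω) : MeasurableSet (unexhausted (Ψ ω) (F ω)) :=
  ((measurable_outMass hΨ hF).comp measurable_prodMk_left) (measurableSet_singleton 1).compl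

theorem ae_measure_unexhausted_eq_zero_or_ae_eq_top [MeasurableConstVAdd (E d) Ω] (hd : 1 ≤ d)
    (hP : IsErgodic d P) (hΦ : IsFlowAdaptedMeasure Φ) (hΨ : IsFlowAdaptedMeasure Ψ)
    (hF : IsFlowAdaptedFunction F) :
    (∀ᵐ ω ∂P, Φ ω (unexhausted (Ψ ω) (F ω)) = 0) ∨
      ∀ᵐ ω ∂P, Φ ω (unexhausted (Ψ ω) (F ω)) = ∞ := by
  let g (ω : Ω) : E d → ℝ≥0∞ := (unexhausted (Ψ ω) (F ω)).indicator 1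
  have hg : Measurable (Function.uncurry g) :=
    measurable_one.indicator (measurable_outMass hΨ hF (measurableSet_singleton 1).compl)
  have hg_vadd (s : E d) (ω : Ω) (x : E d) : g (s +ᵥ ω) x = g ω (s +ᵥ x) := by
    simp only [g, Set.indicator, unexhausted, Set.mem_ofPred_eq, outMass_vadd hΨ hF, vadd_eq_add,
      Pi.one_apply]
  have hmass (ω : Ω) :
      hΦ.kernel.withDensity g ω Set.univ = Φ ω (unexhausted (Ψ ω) (F ω)) := by
    rw [Kernel.withDensity_apply _ hg,
      withDensity_indicator_one (measurableSet_unexhausted hΨ hF ω), Measure.restrict_apply_univ]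
    rfl
  have : IsSFiniteKernel (hΦ.kernel.withDensity g) :=
    Kernel.IsSFiniteKernel.withDensity _ fun ω x => by
      simp only [g, Set.indicator]; split_ifs <;> simp
  simpa only [hmass] using hP.ae_measure_univ_eq_zero_or_ae_measure_univ_eq_top hd
    (hΦ.isFlowCovariant_kernel.withDensity hg hg_vadd)

end RandomMeasure

section MassTransport

variable {d : ℕ}

theorem withDensity_prod_apply_prod_univ {φ ψ : Measure (E d)} [SFinite φ] [SFinite ψ]
    {f : E d → E d → ℝ} (hf : Measurable (Function.uncurry f)) {B : Set (E d)}
    (hB : MeasurableSet B) :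
    (φ.prod ψ).withDensity (fun p => ENNReal.ofReal (f p.1 p.2)) (B ×ˢ Set.univ) =
      ∫⁻ x in B, outMass ψ f x ∂φ := by
  rw [withDensity_apply _ (hB.prod MeasurableSet.univ), ← Measure.prod_restrict,
    Measure.restrict_univ]
  exact lintegral_prod _ hf.ennreal_ofReal.aemeasurable

theorem withDensity_prod_apply_univ_prod {φ ψ : Measure (E d)} [SFinite φ] [SFinite ψ]
    {f : E d → E d → ℝ} (hf : Measurable (Function.uncurry f)) {B : Set (E d)}
    (hB : MeasurableSet B) :
    (φ.prod ψ).withDensity (fun p => ENNReal.ofReal (f p.1 p.2)) (Set.univ ×ˢ B) =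
      ∫⁻ ξ in B, inMass φ f ξ ∂ψ := by
  rw [withDensity_apply _ (MeasurableSet.univ.prod hB), ← Measure.prod_restrict,
    Measure.restrict_univ]
  exact lintegral_prod_symm _ hf.ennreal_ofReal.aemeasurable

variable {Ω : Type*} [MeasurableSpace Ω] [AddAction (E d) Ω] [MeasurableConstVAdd (E d) Ω]
  {P : Measure Ω} {Φ Ψ : Ω → Measure (E d)} {F : Ω → E d → E d → ℝ}

theorem lintegral_outMass_eq_lintegral_inMass [SFinite P] [VAddInvariantMeasure (E d) Ω P]
    (hΦ : IsFlowAdaptedMeasure Φ) (hΨ : IsFlowAdaptedMeasure Ψ) (hF : IsFlowAdaptedFunction F)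
    {B : Set (E d)} (hB : MeasurableSet B) :
    ∫⁻ ω, ∫⁻ x in B, outMass (Ψ ω) (F ω) x ∂Φ ω ∂P =
      ∫⁻ ω, ∫⁻ ξ in B, inMass (Φ ω) (F ω) ξ ∂Ψ ω ∂P := by
  have := hΦ.sFinite
  have := hΨ.sFinite
  let g (ω : Ω) (p : E d × E d) : ℝ≥0∞ := ENNReal.ofReal (F ω p.1 p.2)
  have hg : Measurable (Function.uncurry g) := hF.measurable.ennreal_ofReal
  have hFω (ω : Ω) : Measurable (Function.uncurry (F ω)) :=
    hF.measurable.comp measurable_prodMk_left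
  let κ : Kernel Ω (E d × E d) := (hΦ.kernel ×ₖ hΨ.kernel).withDensity g
  have hκ_apply (ω : Ω) : κ ω = ((Φ ω).prod (Ψ ω)).withDensity (g ω) := by
    rw [Kernel.withDensity_apply _ hg, Kernel.prod_apply]
    rfl
  have hκ : IsFlowCovariant (E d) κ :=
    (hΦ.isFlowCovariant_kernel.prod hΨ.isFlowCovariant_kernel).withDensity hg fun s ω p => by
      simp only [g, hF.flowAdapted, add_comm _ s]
      rfl
  have : IsSFiniteKernel κ :=
    Kernel.IsSFiniteKernel.withDensity _ fun _ _ => ENNReal.ofReal_ne_top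
  have := hκ.vaddInvariantMeasure_bind P
  have hmarginal : (κ ∘ₘ P) (B ×ˢ Set.univ) = (κ ∘ₘ P) (Set.univ ×ˢ B) := by
    rw [Set.prod_univ, Set.univ_prod, ← Measure.fst_apply hB, ← Measure.snd_apply hB,
      fst_eq_snd_of_vaddInvariantMeasure (volume : Measure (E d))]
  rw [Measure.bind_apply (hB.prod .univ) κ.aemeasurable,
    Measure.bind_apply (.prod .univ hB) κ.aemeasurable] at hmarginal
  simpa only [hκ_apply, g, withDensity_prod_apply_prod_univ (hFω _) hB,
    withDensity_prod_apply_univ_prod (hFω _) hB] using hmarginal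

end MassTransport

section Saturation

variable {d : ℕ} {φ ψ : Measure (E d)} {f : E d → E d → ℝ}

/-- A sub-balancing density is saturating if it takes values at least `1` on every pair of an
unexhausted site and an unsated center. This is what stability says about such pairs, and it does
not refer to distances. -/
structure IsSaturating (φ ψ : Measure (E d)) (f : E d → E d → ℝ) : Prop where
  subBalancing : IsSubBalancing φ ψ f
  one_le : ∀ x ∈ unexhausted ψ f, ∀ ξ ∈ unsated φ f, 1 ≤ f x ξ

theorem IsStableConstrained.isSaturating (hf : IsStableConstrained φ ψ f) :
    IsSaturating φ ψ f where
  subBalancing := hf.constrained.subBalancing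
  one_le x hx ξ hξ := by
    by_contra! hlt
    exact hf.stable ⟨x, ξ, ⟨hlt, Or.inl hx⟩, ⟨hlt, Or.inl hξ⟩⟩

namespace IsSaturating

theorem swap (hf : IsSaturating φ ψ f) : IsSaturating ψ φ fun ξ x => f x ξ where
  subBalancing :=
    { measurable := hf.subBalancing.measurable.comp measurable_swap
      nonneg := fun ξ x => hf.subBalancing.nonneg x ξ
      outMass_le := hf.subBalancing.inMass_le
      inMass_le := hf.subBalancing.outMass_le }
  one_le ξ hξ x hx := hf.one_le x hx ξ hξ

theorem measure_unexhausted_lt_one (hf : IsSaturating φ ψ f) {ξ : E d} (hξ : ξ ∈ unsated φ f) :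
    φ (unexhausted ψ f) < 1 := by
  have hfξ : Measurable fun x => ENNReal.ofReal (f x ξ) :=
    (hf.subBalancing.measurable.comp measurable_prodMk_right).ennreal_ofReal
  calc φ (unexhausted ψ f)
      ≤ φ {x | 1 ≤ ENNReal.ofReal (f x ξ)} :=
        measure_mono fun x hx => ENNReal.one_le_ofReal.2 (hf.one_le x hx ξ hξ)
    _ ≤ inMass φ f ξ :=
        (one_mul _).symm.trans_le (mul_meas_ge_le_lintegral hfξ 1)
    _ < 1 := (hf.subBalancing.inMass_le ξ).lt_of_ne hξ

theorem unsated_eq_empty (hf : IsSaturating φ ψ f) (h : φ (unexhausted ψ f) = ∞) :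
    unsated φ f = ∅ :=
  Set.eq_empty_of_forall_notMem fun _ hξ =>
    ((hf.measure_unexhausted_lt_one hξ).trans ENNReal.one_lt_top).ne h

end IsSaturating

end Saturation

section Intensity

variable {d : ℕ} {Ω : Type*} [MeasurableSpace Ω] {P : Measure Ω} {Φ Ψ : Ω → Measure (E d)}
  {F : Ω → E d → E d → ℝ} {c : ℝ≥0∞} {B : Set (E d)}

theorem lintegral_outMass_le (hc : IsIntensity P Φ c)
    (hout : ∀ᵐ ω ∂P, ∀ x, outMass (Ψ ω) (F ω) x ≤ 1) (hB : MeasurableSet B) :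
    ∫⁻ ω, ∫⁻ x in B, outMass (Ψ ω) (F ω) x ∂Φ ω ∂P ≤ c * volume B := by
  rw [← hc B hB]
  refine lintegral_mono_ae (hout.mono fun ω hω => ?_)
  exact (lintegral_mono hω).trans_eq (by simp)

theorem lintegral_outMass_of_ae_exhausted (hc : IsIntensity P Φ c)
    (h : ∀ᵐ ω ∂P, Φ ω (unexhausted (Ψ ω) (F ω)) = 0) (hB : MeasurableSet B) :
    ∫⁻ ω, ∫⁻ x in B, outMass (Ψ ω) (F ω) x ∂Φ ω ∂P = c * volume B := by
  rw [← hc B hB]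
  refine lintegral_congr_ae (h.mono fun ω hω => ?_)
  have hone : ∀ᵐ x ∂(Φ ω).restrict B, outMass (Ψ ω) (F ω) x = 1 := ae_restrict_of_ae hω
  exact (lintegral_congr_ae hone).trans (by simp)

end Intensity

section Campbell

variable {d : ℕ} {Ω : Type*} [MeasurableSpace Ω] [AddAction (E d) Ω] {P : Measure Ω} [SFinite P]
  {Φ Ψ : Ω → Measure (E d)} {F : Ω → E d → E d → ℝ} {c : ℝ≥0∞} {B : Set (E d)}

theorem IsIntensity.compProd_univ_prod (hc : IsIntensity P Φ c) (hΦ : IsFlowAdaptedMeasure Φ)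
    (hB : MeasurableSet B) : (P ⊗ₘ hΦ.kernel) (Set.univ ×ˢ B) = c * volume B := by
  rw [Measure.compProd_apply_prod MeasurableSet.univ hB, Measure.restrict_univ, ← hc B hB]
  rfl

theorem setLIntegral_compProd_outMass (hΦ : IsFlowAdaptedMeasure Φ) (hΨ : IsFlowAdaptedMeasure Ψ)
    (hF : IsFlowAdaptedFunction F) (hB : MeasurableSet B) :
    ∫⁻ p in Set.univ ×ˢ B, outMass (Ψ p.1) (F p.1) p.2 ∂(P ⊗ₘ hΦ.kernel) =
      ∫⁻ ω, ∫⁻ x in B, outMass (Ψ ω) (F ω) x ∂Φ ω ∂P := by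
  rw [Measure.setLIntegral_compProd (measurable_outMass hΨ hF) MeasurableSet.univ hB,
    Measure.restrict_univ]
  rfl

theorem ae_compProd_outMass_eq_one_iff (hΦ : IsFlowAdaptedMeasure Φ)
    (hΨ : IsFlowAdaptedMeasure Ψ) (hF : IsFlowAdaptedFunction F) :
    (∀ᵐ p ∂(P ⊗ₘ hΦ.kernel), outMass (Ψ p.1) (F p.1) p.2 = 1) ↔
      ∀ᵐ ω ∂P, Φ ω (unexhausted (Ψ ω) (F ω)) = 0 :=
  Measure.ae_compProd_iff (measurable_outMass hΨ hF (measurableSet_singleton 1))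

theorem ae_exhausted_of_le_lintegral_outMass (hΦ : IsFlowAdaptedMeasure Φ)
    (hΨ : IsFlowAdaptedMeasure Ψ) (hF : IsFlowAdaptedFunction F) (hc : IsIntensity P Φ c)
    (hc_top : c ≠ ∞) (hout : ∀ᵐ ω ∂P, ∀ x, outMass (Ψ ω) (F ω) x ≤ 1)
    (hle : ∀ B, MeasurableSet B →
      c * volume B ≤ ∫⁻ ω, ∫⁻ x in B, outMass (Ψ ω) (F ω) x ∂Φ ω ∂P) :
    ∀ᵐ ω ∂P, Φ ω (unexhausted (Ψ ω) (F ω)) = 0 := by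
  have hmeas := measurable_outMass hΨ hF
  have hle_one : ∀ᵐ p ∂(P ⊗ₘ hΦ.kernel), outMass (Ψ p.1) (F p.1) p.2 ≤ 1 :=
    (Measure.ae_compProd_iff (measurableSet_le hmeas measurable_const)).2
      (hout.mono fun ω hω => ae_of_all _ hω)
  have hwindow (n : ℕ) : ∀ᵐ p ∂(P ⊗ₘ hΦ.kernel).restrict (Set.univ ×ˢ spanningSets volume n),
      outMass (Ψ p.1) (F p.1) p.2 = 1 := by
    have hB := measurableSet_spanningSets (volume : Measure (E d)) n
    refine ae_eq_of_ae_le_of_lintegral_le (ae_restrict_of_ae hle_one) ?_ aemeasurable_const ?_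
    · rw [setLIntegral_compProd_outMass hΦ hΨ hF hB]
      refine ((lintegral_outMass_le hc hout hB).trans_lt ?_).ne
      exact ENNReal.mul_lt_top hc_top.lt_top (measure_spanningSets_lt_top _ n)
    · rw [setLIntegral_compProd_outMass hΦ hΨ hF hB, setLIntegral_one,
        hc.compProd_univ_prod hΦ hB]
      exact hle _ hB
  rw [← ae_compProd_outMass_eq_one_iff hΦ hΨ hF]
  rw [← ae_restrict_iUnion_iff, ← Set.prod_iUnion, iUnion_spanningSets, Set.univ_prod_univ,
    Measure.restrict_univ] at hwindow
  exact hwindow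

end Campbell

section IntensityComparison

variable {d : ℕ} {Ω : Type*} [MeasurableSpace Ω] [AddAction (E d) Ω]
  [MeasurableConstVAdd (E d) Ω] {P : Measure Ω} {Φ Ψ : Ω → Measure (E d)}
  {F : Ω → E d → E d → ℝ} {lamΦ lamΨ : ℝ≥0∞}

theorem intensity_le_of_ae_exhausted [SFinite P] [VAddInvariantMeasure (E d) Ω P]
    (hΦ : IsFlowAdaptedMeasure Φ) (hΨ : IsFlowAdaptedMeasure Ψ)
    (hlamΦ : IsIntensity P Φ lamΦ) (hlamΨ : IsIntensity P Ψ lamΨ) (hF : IsFlowAdaptedFunction F)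
    (hin : ∀ᵐ ω ∂P, ∀ ξ, inMass (Φ ω) (F ω) ξ ≤ 1)
    (hexh : ∀ᵐ ω ∂P, Φ ω (unexhausted (Ψ ω) (F ω)) = 0) : lamΦ ≤ lamΨ := by
  have hball : MeasurableSet (Metric.ball (0 : E d) 1) := measurableSet_ball
  have hpos : volume (Metric.ball (0 : E d) 1) ≠ 0 := (Metric.measure_ball_pos _ _ one_pos).ne'
  rw [← ENNReal.mul_le_mul_iff_left hpos measure_ball_lt_top.ne,
    ← lintegral_outMass_of_ae_exhausted hlamΦ hexh hball,
    lintegral_outMass_eq_lintegral_inMass hΦ hΨ hF hball]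
  exact lintegral_outMass_le hlamΨ hin hball

theorem ae_exhausted_of_ae_sated [SFinite P] [VAddInvariantMeasure (E d) Ω P]
    (hΦ : IsFlowAdaptedMeasure Φ) (hΨ : IsFlowAdaptedMeasure Ψ) {lam : ℝ≥0∞}
    (hlamΦ : IsIntensity P Φ lam) (hlamΨ : IsIntensity P Ψ lam) (hlam : lam ≠ ∞)
    (hF : IsFlowAdaptedFunction F) (hout : ∀ᵐ ω ∂P, ∀ x, outMass (Ψ ω) (F ω) x ≤ 1)
    (hsat : ∀ᵐ ω ∂P, Ψ ω (unsated (Φ ω) (F ω)) = 0) :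
    ∀ᵐ ω ∂P, Φ ω (unexhausted (Ψ ω) (F ω)) = 0 := by
  refine ae_exhausted_of_le_lintegral_outMass hΦ hΨ hF hlamΦ hlam hout fun B hB => ?_
  rw [lintegral_outMass_eq_lintegral_inMass hΦ hΨ hF hB]
  exact (lintegral_outMass_of_ae_exhausted hlamΨ hsat hB).ge

variable (hd : 1 ≤ d) (hP : IsErgodic d P) (hΦ : IsFlowAdaptedMeasure Φ)
  (hΨ : IsFlowAdaptedMeasure Ψ) (hF : IsFlowAdaptedFunction F)
  (hF_sat : ∀ᵐ ω ∂P, IsSaturating (Φ ω) (Ψ ω) (F ω))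
include hd hP hΦ hΨ hF hF_sat

theorem ae_unsated_eq_empty_and_measure_unexhausted_eq_top (hlamΦ : IsIntensity P Φ lamΦ)
    (hlamΨ : IsIntensity P Ψ lamΨ) (hlt : lamΨ < lamΦ) :
    ∀ᵐ ω ∂P, unsated (Φ ω) (F ω) = ∅ ∧ Φ ω (unexhausted (Ψ ω) (F ω)) = ∞ := by
  have := hP.isProbabilityMeasure
  have := hP.vaddInvariantMeasure
  rcases ae_measure_unexhausted_eq_zero_or_ae_eq_top hd hP hΦ hΨ hF with hexh | htop
  · exact absurd hlt (intensity_le_of_ae_exhausted hΦ hΨ hlamΦ hlamΨ hF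
      (hF_sat.mono fun ω hω => hω.subBalancing.inMass_le) hexh).not_gt
  · filter_upwards [hF_sat, htop] with ω hω hω_top using ⟨hω.unsated_eq_empty hω_top, hω_top⟩

theorem ae_measure_unexhausted_eq_zero {lam : ℝ≥0∞} (hlamΦ : IsIntensity P Φ lam)
    (hlamΨ : IsIntensity P Ψ lam) (hlam : lam ≠ ∞) :
    ∀ᵐ ω ∂P, Φ ω (unexhausted (Ψ ω) (F ω)) = 0 := by
  have := hP.isProbabilityMeasure
  have := hP.vaddInvariantMeasure
  rcases ae_measure_unexhausted_eq_zero_or_ae_eq_top hd hP hΦ hΨ hF with hexh | htop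
  · exact hexh
  · refine ae_exhausted_of_ae_sated hΦ hΨ hlamΦ hlamΨ hlam hF
      (hF_sat.mono fun ω hω => hω.subBalancing.outMass_le) ?_
    filter_upwards [hF_sat, htop] with ω hω hω_top
    rw [hω.unsated_eq_empty hω_top, measure_empty]

end IntensityComparison

end StableTransport

theorem theorem3p9_general {d : ℕ} (hd : 1 ≤ d) {Ω : Type*} [MeasurableSpace Ω]
    [AddAction (E d) Ω] [MeasurableConstVAdd (E d) Ω] {P : Measure Ω} {Φ Ψ : Ω → Measure (E d)}
    (hP : IsErgodic d P) (hΦ : IsFlowAdaptedMeasure Φ) (hΨ : IsFlowAdaptedMeasure Ψ)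
    {lamΦ lamΨ : ℝ≥0∞} (hlamΦ : IsIntensity P Φ lamΦ) (hlamΨ : IsIntensity P Ψ lamΨ)
    (hfin : lamΦ ≠ ∞ ∨ lamΨ ≠ ∞) {F : Ω → E d → E d → ℝ} (hF : IsFlowAdaptedFunction F)
    (hF_sat : ∀ᵐ ω ∂P, IsSaturating (Φ ω) (Ψ ω) (F ω)) :
    ∀ᵐ ω ∂P,
      (lamΦ = lamΨ →
        IsBalancing (Φ ω) (Ψ ω) (F ω) ∧
        Φ ω (unexhausted (Ψ ω) (F ω)) = 0 ∧ Ψ ω (unsated (Φ ω) (F ω)) = 0) ∧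
      (lamΦ < lamΨ →
        unexhausted (Ψ ω) (F ω) = ∅ ∧ Ψ ω (unsated (Φ ω) (F ω)) = ∞) ∧
      (lamΨ < lamΦ →
        unsated (Φ ω) (F ω) = ∅ ∧ Φ ω (unexhausted (Ψ ω) (F ω)) = ∞) := by
  have hF_swap : ∀ᵐ ω ∂P, IsSaturating (Ψ ω) (Φ ω) fun ξ x => F ω x ξ :=
    hF_sat.mono fun _ hω => hω.swap
  rw [Filter.eventually_and, Filter.eventually_and]
  simp only [Filter.eventually_imp_distrib_left]
  refine ⟨?_, fun hlt => ?_, fun hlt => ?_⟩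
  · rintro rfl
    have hlam : lamΦ ≠ ∞ := hfin.elim id id
    filter_upwards [hF_sat, ae_measure_unexhausted_eq_zero hd hP hΦ hΨ hF hF_sat hlamΦ hlamΨ hlam,
      ae_measure_unexhausted_eq_zero hd hP hΨ hΦ hF.swap hF_swap hlamΨ hlamΦ hlam]
      with ω hω hexh hsat using ⟨⟨hω.subBalancing, hexh, hsat⟩, hexh, hsat⟩
  · exact ae_unsated_eq_empty_and_measure_unexhausted_eq_top hd hP hΨ hΦ hF.swap hF_swap
      hlamΨ hlamΦ hlt
  · exact ae_unsated_eq_empty_and_measure_unexhausted_eq_top hd hP hΦ hΨ hF hF_sat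
      hlamΦ hlamΨ hlt

theorem theorem3p9 {d : ℕ} (hd : 1 ≤ d) {Ω : Type*} [MeasurableSpace Ω]
    [AddAction (E d) Ω] [MeasurableVAdd₂ (E d) Ω]
    (P : Measure Ω) (Φ Ψ : Ω → Measure (E d))
    (hΦ : IsErgodicRandomMeasure P Φ) (hΨ : IsErgodicRandomMeasure P Ψ)
    (lamΦ lamΨ : ℝ≥0∞)
    (hlamΦ : IsIntensity P Φ lamΦ) (hlamΦ_pos : 0 < lamΦ) (hlamΦ_fin : lamΦ < ∞)
    (hlamΨ : IsIntensity P Ψ lamΨ) (hlamΨ_pos : 0 < lamΨ) (hlamΨ_fin : lamΨ < ∞)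
    (F : Ω → E d → E d → ℝ) (hF : IsFlowAdaptedFunction F)
    (hF_stable : ∀ᵐ ω ∂P, IsStableConstrained (Φ ω) (Ψ ω) (F ω)) :
    ∀ᵐ ω ∂P,
      (lamΦ = lamΨ →
        IsBalancing (Φ ω) (Ψ ω) (F ω) ∧
        Φ ω (unexhausted (Ψ ω) (F ω)) = 0 ∧ Ψ ω (unsated (Φ ω) (F ω)) = 0) ∧
      (lamΦ < lamΨ →
        unexhausted (Ψ ω) (F ω) = ∅ ∧ Ψ ω (unsated (Φ ω) (F ω)) = ∞) ∧
      (lamΨ < lamΦ →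
        unsated (Φ ω) (F ω) = ∅ ∧ Φ ω (unexhausted (Ψ ω) (F ω)) = ∞) := by
  exact theorem3p9_general hd hΦ.ergodic hΦ.flowAdapted hΨ.flowAdapted hlamΦ hlamΨ
    (Or.inl hlamΦ_fin.ne) hF (hF_stable.mono fun _ hω => hω.isSaturating)
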